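/- Let $M$ be a smooth ($C^\infty$) compact Riemannian manifold (without boundary) of dimension $d$, with Riemannian volume $\mathrm{d}x$, and let $m > 2d+1$. Let $D_+^1(M,\mathbb{R}^m)$ be the set of $m$-tuples $(\rho_1,\dots,\rho_m)$ of strictly positive $C^1$ functions on $M$ with $\int_M \rho_j\,\mathrm{d}x = 1$ for all $j$, and let $\boldsymbol{D}$ be the set of those $(\rho_1,\dots,\rho_m)\in D_+^1(M,\mathbb{R}^m)$ for which $$\Big(\frac{\rho_1}{\rho_m},\dots,\frac{\rho_{m-1}}{\rho_m}\Big): M\to\mathbb{R}^{m-1}$$ is a $C^1$ embedding (injective, with injective differential at every point, and a homeomorphism onto its image). Let $(\rho_1,\dots,\rho_m)\in\boldsymbol{D}$, let $v,w$ be $C^1$ vector fields on $M$, let $A:TM\to TM$ be a bounded Borel measurable diffusion tensor (linear on each tangent space; symmetry and positivity are not needed), and let $R:L^1(M)\to L^1(M)$ be an arbitrary map. For a vector field $u\in\{v,w\}$ consider the advection--diffusion--reaction operator $$\mathcal{L}^{(u)}[\rho] = \operatorname{div}(\rho u) - \operatorname{div}(A\nabla\rho) + R(\rho),$$ understood weakly,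 that is, through its pairing with $\phi\in C_c^\infty(M)$, $$\langle \mathcal{L}^{(u)}[\rho],\phi\rangle = \int_M \operatorname{div}(\rho u)\,\phi\,\mathrm{d}x + \int_M \langle\nabla\phi, A\nabla\rho\rangle\,\mathrm{d}x + \int_M R(\rho)\,\phi\,\mathrm{d}x .$$ If $\langle\mathcal{L}^{(v)}[\rho_j],\phi\rangle = \langle\mathcal{L}^{(w)}[\rho_j],\phi\rangle$ for all $\phi\in C_c^\infty(M)$ and all $1\le j\le m$, then $v(x)=w(x)$ for all $x\in M$. -/

import Mathlib

open MeasureTheory Bundle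
open scoped Manifold ContDiff

attribute [local instance 2000] chartedSpaceSelf

noncomputable section

section Riemannian

variable {d : ℕ} {M : Type*} [TopologicalSpace M] [ChartedSpace (EuclideanSpace ℝ (Fin d)) M]

/-- A map `Y : M → ℝᵏ` of class `C¹` is an embedding if it is injective, all its differentials
are injective, and it is a homeomorphism onto its image. -/
structure IsC1Embedding {k : ℕ} (Y : M → EuclideanSpace ℝ (Fin k)) : Prop where
  contMDiff : ContMDiff (𝓡 d) (𝓡 k) 1 Y
  injective : Function.Injective Y
  injective_mfderiv : ∀ x : M, Function.Injective (mfderiv (𝓡 d) (𝓡 k) Y x)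
  isEmbedding : Topology.IsEmbedding Y

/-- `v ∈ 𝔛¹(M)`: the vector field `v` is of class `C¹`. -/
def IsC1VectorField [IsManifold (𝓡 d) ∞ M] (v : (x : M) → TangentSpace (𝓡 d) x) : Prop :=
  ContMDiff (𝓡 d) (𝓡 d).tangent 1 (fun x ↦ (⟨x, v x⟩ : TangentBundle (𝓡 d) M))

/-- The coordinate vector field `∂ᵢ` of the chart around `x`, at the point of `M` with
coordinates `y`. -/
def coordVector (x : M) (y : EuclideanSpace ℝ (Fin d)) (i : Fin d) :
    TangentSpace (𝓡 d) ((extChartAt (𝓡 d) x).symm y) :=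
  mfderiv (𝓡 d) (𝓡 d) (extChartAt (𝓡 d) x).symm y (EuclideanSpace.single i (1 : ℝ))

/-- The components `Vⁱ` of the vector field `V` in the chart around `x`, at the point of `M` with
coordinates `y`. -/
def coordField (V : (p : M) → TangentSpace (𝓡 d) p) (x : M) (y : EuclideanSpace ℝ (Fin d)) :
    EuclideanSpace ℝ (Fin d) :=
  mfderiv (𝓡 d) (𝓡 d) (extChartAt (𝓡 d) x) ((extChartAt (𝓡 d) x).symm y)
    (V ((extChartAt (𝓡 d) x).symm y))

variable [RiemannianBundle (fun x : M ↦ TangentSpace (𝓡 d) x)]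

/-- The matrix `gᵢⱼ = ⟨∂ᵢ, ∂ⱼ⟩` of the Riemannian metric in the chart around `x`, at the point of
`M` with coordinates `y`. -/
def gramMatrix (x : M) (y : EuclideanSpace ℝ (Fin d)) : Matrix (Fin d) (Fin d) ℝ :=
  Matrix.of fun i j ↦ inner ℝ (coordVector x y i) (coordVector x y j)

/-- The density `√det(gᵢⱼ)` of the Riemannian volume in the chart around `x`. -/
def volumeDensity (x : M) (y : EuclideanSpace ℝ (Fin d)) : ℝ :=
  √(gramMatrix x y).det

/-- The Riemannian volume of the domain of the chart around `x`: the image of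
`√det(gᵢⱼ) dy` under the inverse chart. -/
def chartVolume [MeasurableSpace M] (x : M) : Measure M :=
  ((volume.restrict (extChartAt (𝓡 d) x).target).withDensity
    (fun y ↦ ENNReal.ofReal (volumeDensity x y))).map (extChartAt (𝓡 d) x).symm

variable (d M) in
/-- The Riemannian volume measure: the least measure that dominates the volumes of all the chart
domains. The latter agree on the intersections of chart domains, so that on every
chart domain the Riemannian volume is given by `√det(gᵢⱼ) dy`. -/
def riemannianVolume [MeasurableSpace M] : Measure M :=
  ⨆ x : M, chartVolume (d := d) x

/-- The Riemannian divergence `div V = (1/√g) ∑ᵢ ∂ᵢ(√g Vⁱ)`, `g = det(gᵢⱼ)`, computed at `x` in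
the chart around `x`. -/
def riemannianDiv (V : (p : M) → TangentSpace (𝓡 d) p) (x : M) : ℝ :=
  (volumeDensity x (extChartAt (𝓡 d) x x))⁻¹ *
    ∑ i : Fin d, fderiv ℝ (fun y ↦ volumeDensity x y * coordField V x y i)
      (extChartAt (𝓡 d) x x) (EuclideanSpace.single i (1 : ℝ))

instance tangentSpace_finiteDimensional (x : M) : FiniteDimensional ℝ (TangentSpace (𝓡 d) x) :=
  inferInstanceAs (FiniteDimensional ℝ (EuclideanSpace ℝ (Fin d)))

/-- The Riemannian gradient: `⟨∇f(x), u⟩ = df_x(u)` for all `u`. -/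
def riemannianGrad (f : M → ℝ) (x : M) : TangentSpace (𝓡 d) x :=
  have : CompleteSpace (TangentSpace (𝓡 d) x) := FiniteDimensional.complete ℝ _
  (InnerProductSpace.toDual ℝ (TangentSpace (𝓡 d) x)).symm (mfderiv (𝓡 d) 𝓘(ℝ, ℝ) f x)

theorem inner_riemannianGrad (f : M → ℝ) (x : M) (u : TangentSpace (𝓡 d) x) :
    inner ℝ (riemannianGrad f x) u = (mfderiv (𝓡 d) 𝓘(ℝ, ℝ) f x u : ℝ) := by
  have : CompleteSpace (TangentSpace (𝓡 d) x) := FiniteDimensional.complete ℝ _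
  exact InnerProductSpace.toDual_symm_apply

/-- The diffusion tensor `A : TM → TM`, linear on each tangent space, is a Borel map. -/
def IsMeasurableTensor [IsManifold (𝓡 d) ∞ M]
    (A : (x : M) → TangentSpace (𝓡 d) x →L[ℝ] TangentSpace (𝓡 d) x) : Prop :=
  @Measurable (TangentBundle (𝓡 d) M) (TangentBundle (𝓡 d) M) (borel _) (borel _)
    (fun p ↦ ⟨p.1, A p.1 p.2⟩)

/-- The diffusion tensor `A` is bounded (with respect to the Riemannian norm). -/
def IsBoundedTensor
    (A : (x : M) → TangentSpace (𝓡 d) x →L[ℝ] TangentSpace (𝓡 d) x) : Prop :=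
  ∃ C : ℝ, ∀ (x : M) (u : TangentSpace (𝓡 d) x), ‖A x u‖ ≤ C * ‖u‖

variable [MeasurableSpace M]

variable (d M) in
/-- `D₊¹(M, ℝᵐ)`: the `m`-tuples of strictly positive `C¹` functions of Riemannian integral `1`. -/
def positiveDensities (m : ℕ) : Set (Fin m → M → ℝ) :=
  {ρ | ∀ j, ContMDiff (𝓡 d) 𝓘(ℝ, ℝ) 1 (ρ j) ∧ (∀ x, 0 < ρ j x) ∧
    ∫ x, ρ j x ∂(riemannianVolume d M) = 1}

/-- The map `(ρ₁/ρₘ, …, ρₘ₋₁/ρₘ) : M → ℝᵐ⁻¹`. -/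
def ratioMap {m : ℕ} (hm : 0 < m) (ρ : Fin m → M → ℝ) (x : M) :
    EuclideanSpace ℝ (Fin (m - 1)) :=
  WithLp.toLp 2 fun j ↦ ρ ⟨j, by omega⟩ x / ρ ⟨m - 1, by omega⟩ x

variable (d M) in
/-- The set `𝐃` of the `ρ ∈ D₊¹(M, ℝᵐ)` for which `(ρ₁/ρₘ, …, ρₘ₋₁/ρₘ)` is an embedding. -/
def densitySet {m : ℕ} (hm : 0 < m) : Set (Fin m → M → ℝ) :=
  {ρ | ρ ∈ positiveDensities d M m ∧ IsC1Embedding (d := d) (ratioMap hm ρ)}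

theorem integrable_of_mem_densitySet {m : ℕ} {hm : 0 < m} {ρ : Fin m → M → ℝ}
    (hρ : ρ ∈ densitySet d M hm) (j : Fin m) : Integrable (ρ j) (riemannianVolume d M) := by
  by_contra h
  have h1 := (hρ.1 j).2.2
  rw [integral_undef h] at h1
  exact zero_ne_one h1

/-- The pairing of `ℒ⁽ᵛ⁾[ρ] = div(ρ v) - div(A ∇ρ) + R(ρ)` with the test function `φ`:
`∫ div(ρ v) φ + ∫ ⟨∇φ, A ∇ρ⟩ + ∫ R(ρ) φ`. -/
def adrPairing (A : (x : M) → TangentSpace (𝓡 d) x →L[ℝ] TangentSpace (𝓡 d) x)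
    (R : Lp ℝ 1 (riemannianVolume d M) → Lp ℝ 1 (riemannianVolume d M))
    (v : (x : M) → TangentSpace (𝓡 d) x)
    (ρ : M → ℝ) (hρ : Integrable ρ (riemannianVolume d M)) (φ : M → ℝ) : ℝ :=
  (∫ x, riemannianDiv (fun p ↦ ρ p • v p) x * φ x ∂(riemannianVolume d M)) +
  (∫ x, inner ℝ (riemannianGrad (d := d) φ x) (A x (riemannianGrad ρ x))
      ∂(riemannianVolume d M)) +
  ∫ x, R (hρ.toL1 ρ) x * φ x ∂(riemannianVolume d M)

/-- `ℒ⁽ᵛ⁾[ρ] = ℒ⁽ʷ⁾[ρ]` weakly, i.e. when tested against every `φ ∈ C_c^∞(M)`. -/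
def ADRWeakEq (A : (x : M) → TangentSpace (𝓡 d) x →L[ℝ] TangentSpace (𝓡 d) x)
    (R : Lp ℝ 1 (riemannianVolume d M) → Lp ℝ 1 (riemannianVolume d M))
    (v w : (x : M) → TangentSpace (𝓡 d) x)
    (ρ : M → ℝ) (hρ : Integrable ρ (riemannianVolume d M)) : Prop :=
  ∀ φ : M → ℝ, ContMDiff (𝓡 d) 𝓘(ℝ, ℝ) ∞ φ → HasCompactSupport φ →
    adrPairing A R v ρ hρ φ = adrPairing A R w ρ hρ φ

end Riemannian

end

/-! ### Jacobi's formula and the Piola identity in Euclidean space -/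

section Piola

variable {d : ℕ}

local notation "𝔼" => EuclideanSpace ℝ (Fin d)

/-! The diffusion and reaction terms of the pairing do not involve the vector field, so they cancel
and `div(ρⱼ v) = div(ρⱼ w)` holds weakly. Both sides are continuous and the Riemannian volume
charges nonempty open sets, so equality holds pointwise (`ADRWeakEq.riemannianDiv_eq`). With `u = v
- w` this says `div(ρⱼ u) = 0` for every `j`. Writing `ρⱼ u = (ρⱼ/ρₘ) ρₘ u`, the Leibniz rule
(`riemannianDiv_smul`) and `div(ρₘ u) = 0` give `d(ρⱼ/ρₘ)(ρₘ u) = 0`, hence `d(ρⱼ/ρₘ)(u) = 0` since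
`ρₘ > 0`. So `u` lies in the kernel of the differential of the ratio map, which is injective.

Most of the work is the continuity of the divergence. `riemannianDiv` uses a different chart at each
point, so its chart independence must be proved first (`riemannianDiv_eq_of_mem_source`). The field
`√g V` transforms as a vector density, and the Piola identity (`euclideanDiv_piola`) says that the
divergence of such a field transforms like `√g`. -/

theorem differentiable_continuousLinearMap_det :
    Differentiable ℝ (fun A : 𝔼 →L[ℝ] 𝔼 ↦ A.det) := by
  have h : (fun A : 𝔼 →L[ℝ] 𝔼 ↦ A.det) = fun A ↦
      ∑ σ : Equiv.Perm (Fin d), ((Equiv.Perm.sign σ : ℤ) : ℝ) *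
        ∏ i, A (EuclideanSpace.basisFun (Fin d) ℝ i) (σ i) := by
    funext A
    rw [ContinuousLinearMap.det, ← LinearMap.det_toMatrix
      (EuclideanSpace.basisFun (Fin d) ℝ).toBasis, Matrix.det_apply']
    simp [LinearMap.toMatrix_apply]
  rw [h]
  fun_prop

/-- Jacobi's formula at an invertible endomorphism. -/
theorem fderiv_continuousLinearMap_det {A B : 𝔼 →L[ℝ] 𝔼} (hAB : A ∘L B = .id ℝ 𝔼)
    (H : 𝔼 →L[ℝ] 𝔼) :
    fderiv ℝ (fun A : 𝔼 →L[ℝ] 𝔼 ↦ A.det) A H =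
      A.det * LinearMap.trace ℝ 𝔼 (B ∘L H : 𝔼 →L[ℝ] 𝔼) := by
  let b := (EuclideanSpace.basisFun (Fin d) ℝ).toBasis
  have h1 : HasDerivAt (fun t : ℝ ↦ (A + t • H).det)
      (fderiv ℝ (fun A : 𝔼 →L[ℝ] 𝔼 ↦ A.det) A H) 0 := by
    have h2 : HasDerivAt (fun t : ℝ ↦ A + t • H) H 0 := by
      simpa using ((hasDerivAt_id (0 : ℝ)).smul_const H).const_add A
    exact (differentiable_continuousLinearMap_det A).hasFDerivAt.comp_hasDerivAt_of_eq 0 h2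
      (by ext; simp)
  let N := LinearMap.toMatrix b b ((B ∘L H : 𝔼 →L[ℝ] 𝔼) : 𝔼 →ₗ[ℝ] 𝔼)
  -- Factoring `A + tH = A(1 + tBH)` reduces the derivative to the linear coefficient of `det(1 +
  -- tN)`, which is `tr N`.
  obtain ⟨p, hp⟩ : ∃ p : Polynomial ℝ, ∀ t : ℝ,
      (1 + t • N).det = 1 + N.trace * t + p.eval t * t ^ 2 :=
    ⟨_, fun t ↦ Matrix.det_one_add_smul t N⟩
  have h4 : (fun t : ℝ ↦ (A + t • H).det) =
      fun t ↦ A.det * (1 + N.trace * t + p.eval t * t ^ 2) := by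
    funext t
    have h5 : A + t • H = A ∘L (.id ℝ 𝔼 + t • (B ∘L H)) := by
      rw [ContinuousLinearMap.comp_add, ContinuousLinearMap.comp_smul,
        ← ContinuousLinearMap.comp_assoc, hAB]
      rfl
    rw [h5, ← hp]
    have h6 : LinearMap.toMatrix b b
        ((.id ℝ 𝔼 + t • (B ∘L H) : 𝔼 →L[ℝ] 𝔼) : 𝔼 →ₗ[ℝ] 𝔼) = 1 + t • N := by
      have : ((.id ℝ 𝔼 + t • (B ∘L H) : 𝔼 →L[ℝ] 𝔼) : 𝔼 →ₗ[ℝ] 𝔼) =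
        LinearMap.id + t • ((B ∘L H : 𝔼 →L[ℝ] 𝔼) : 𝔼 →ₗ[ℝ] 𝔼) := rfl
      rw [this, map_add, map_smul, LinearMap.toMatrix_id]
    rw [← h6, LinearMap.det_toMatrix]
    exact LinearMap.det_comp _ _
  rw [h4] at h1
  have h7 : HasDerivAt (fun t : ℝ ↦ A.det * (1 + N.trace * t + p.eval t * t ^ 2))
      (A.det * N.trace) 0 := by
    have := ((((hasDerivAt_id (0 : ℝ)).const_mul N.trace).const_add 1).add
      ((p.hasDerivAt 0).mul ((hasDerivAt_id (0 : ℝ)).pow 2))).const_mul A.det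
    simpa using this
  rw [h1.unique h7, LinearMap.trace_eq_matrix_trace ℝ b]

/-- The divergence in Euclidean space. -/
noncomputable def euclideanDiv (U : 𝔼 → 𝔼) (y : 𝔼) : ℝ := LinearMap.trace ℝ 𝔼 (fderiv ℝ U y)

theorem sum_fderiv_eq_euclideanDiv {U : 𝔼 → 𝔼} {y : 𝔼} (hU : DifferentiableAt ℝ U y) :
    ∑ i : Fin d, fderiv ℝ (fun y ↦ U y i) y (EuclideanSpace.single i (1 : ℝ)) =
      euclideanDiv U y := by
  rw [euclideanDiv, LinearMap.trace_eq_matrix_trace ℝ (EuclideanSpace.basisFun (Fin d) ℝ).toBasis,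
    Matrix.trace]
  refine Finset.sum_congr rfl fun i _ ↦ ?_
  have : HasFDerivAt (fun y ↦ U y i) (EuclideanSpace.proj i ∘L fderiv ℝ U y) y :=
    (EuclideanSpace.proj i : 𝔼 →L[ℝ] ℝ).hasFDerivAt.comp y hU.hasFDerivAt
  rw [this.fderiv]
  simp [LinearMap.toMatrix_apply]

/-- The Piola identity: the pull-back `U = c · det(DT) · DT⁻¹ W ∘ T` of the vector density `W`
satisfies `div U = c · det(DT) · (div W) ∘ T`. -/
theorem euclideanDiv_piola {T U W : 𝔼 → 𝔼} {y : 𝔼} {c : ℝ} {B : 𝔼 →L[ℝ] 𝔼}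
    (hT : ContDiffAt ℝ 2 T y) (hAB : fderiv ℝ T y ∘L B = .id ℝ 𝔼)
    (hBA : B ∘L fderiv ℝ T y = .id ℝ 𝔼)
    (hU : DifferentiableAt ℝ U y) (hW : DifferentiableAt ℝ W (T y))
    (h : ∀ᶠ z in nhds y, fderiv ℝ T z (U z) = (c * (fderiv ℝ T z).det) • W (T z)) :
    euclideanDiv U y = c * (fderiv ℝ T y).det * euclideanDiv W (T y) := by
  set A := fderiv ℝ T y with hA
  have hT1 : HasFDerivAt T A y := (hT.differentiableAt (by norm_num)).hasFDerivAt
  have hT2 : HasFDerivAt (fderiv ℝ T) (fderiv ℝ (fderiv ℝ T) y) y :=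
    ((hT.fderiv_right (m := 1) (by norm_num)).differentiableAt (by norm_num)).hasFDerivAt
  have hsymm : ∀ a b, fderiv ℝ (fderiv ℝ T) y a b = fderiv ℝ (fderiv ℝ T) y b a :=
    fun a b ↦ (hT.isSymmSndFDerivAt (by simp)) a b
  set Q := fderiv ℝ (fderiv ℝ T) y with hQ
  have hl := hT2.clm_apply hU.hasFDerivAt
  have hdet : HasFDerivAt (fun z ↦ (fderiv ℝ T z).det)
      (fderiv ℝ (fun A : 𝔼 →L[ℝ] 𝔼 ↦ A.det) A ∘L Q) y :=
    (differentiable_continuousLinearMap_det A).hasFDerivAt.comp y hT2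
  have hr := (hdet.const_mul c).smul (hW.hasFDerivAt.comp y hT1)
  -- The transformation law is differentiated at `y`, which brings in the second derivative `Q` of
  -- `T` on the left and, through Jacobi's formula, on the right.
  have key := (hl.congr_of_eventuallyEq (h.mono fun z hz ↦ hz.symm)).unique hr
  have hBA' : ∀ u, B (A u) = u := fun u ↦ congrArg (fun F : 𝔼 →L[ℝ] 𝔼 ↦ F u) hBA
  have h0 : A (U y) = (c * A.det) • W (T y) := h.self_of_nhds
  let ℓ : 𝔼 →ₗ[ℝ] ℝ := LinearMap.trace ℝ 𝔼 ∘ₗ ContinuousLinearMap.coeLM ℝ ∘ₗ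
    ((ContinuousLinearMap.compL ℝ 𝔼 𝔼 𝔼 B : (𝔼 →L[ℝ] 𝔼) →L[ℝ] (𝔼 →L[ℝ] 𝔼)) ∘L Q :
      𝔼 →L[ℝ] 𝔼 →L[ℝ] 𝔼).toLinearMap
  have hℓ : ∀ u, ℓ u = LinearMap.trace ℝ 𝔼 (B ∘L Q u : 𝔼 →L[ℝ] 𝔼) := fun _ ↦ rfl
  -- Solved for `DU`. The rank-one term has trace `ℓ (U y) = tr(B ∘ Q(U y))`, which cancels the
  -- trace of the last term. That last term has this form only because `Q` is symmetric.
  have key2 : (fderiv ℝ U y : 𝔼 →ₗ[ℝ] 𝔼) =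
      (c * A.det) • ((B : 𝔼 →ₗ[ℝ] 𝔼) ∘ₗ ((fderiv ℝ W (T y) : 𝔼 →ₗ[ℝ] 𝔼) ∘ₗ (A : 𝔼 →ₗ[ℝ] 𝔼)))
      + ℓ.smulRight (U y) - ((B ∘L Q (U y) : 𝔼 →L[ℝ] 𝔼) : 𝔼 →ₗ[ℝ] 𝔼) := by
    refine LinearMap.ext fun a ↦ ?_
    have e := congrArg (fun F : 𝔼 →L[ℝ] 𝔼 ↦ B (F a)) key
    have e1 : fderiv ℝ U y a + B (Q a (U y)) =
        (c * A.det) • B (fderiv ℝ W (T y) (A a)) +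
          (c * (A.det * LinearMap.trace ℝ 𝔼 (B ∘L Q a : 𝔼 →L[ℝ] 𝔼))) • B (W (T y)) := by
      rw [← hBA' (fderiv ℝ U y a), ← fderiv_continuousLinearMap_det hAB]
      simpa [← hA] using e
    have e2 : (c * (A.det * LinearMap.trace ℝ 𝔼 (B ∘L Q a : 𝔼 →L[ℝ] 𝔼))) • B (W (T y)) =
        LinearMap.trace ℝ 𝔼 (B ∘L Q a : 𝔼 →L[ℝ] 𝔼) • U y := by
      rw [← hBA' (U y), h0, map_smul, smul_smul]
      congr 1
      ring
    rw [e2, hsymm] at e1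
    exact eq_sub_of_add_eq e1
  rw [euclideanDiv, euclideanDiv, key2, map_sub, map_add, map_smul, LinearMap.trace_smulRight, hℓ,
    add_sub_cancel_right, LinearMap.trace_comp_comm', LinearMap.comp_assoc, smul_eq_mul]
  congr 2
  have : (A : 𝔼 →ₗ[ℝ] 𝔼) ∘ₗ (B : 𝔼 →ₗ[ℝ] 𝔼) = LinearMap.id :=
    congrArg (fun F : 𝔼 →L[ℝ] 𝔼 ↦ (F : 𝔼 →ₗ[ℝ] 𝔼)) hAB
  rw [this, LinearMap.comp_id]

end Piola

/-! ### Gram determinants under a linear change of basis -/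

section GramDet

/-- The Gram matrix changes by the congruence `Nᵀ G N`, with `N` the matrix of `A`. -/
theorem det_gram_comp {d : ℕ} {F : Type*} [NormedAddCommGroup F] [InnerProductSpace ℝ F]
    (S : EuclideanSpace ℝ (Fin d) →ₗ[ℝ] F)
    (A : EuclideanSpace ℝ (Fin d) →L[ℝ] EuclideanSpace ℝ (Fin d)) :
    (Matrix.of fun i j : Fin d ↦ (inner ℝ (S (A (EuclideanSpace.single i (1 : ℝ))))
      (S (A (EuclideanSpace.single j (1 : ℝ)))) : ℝ)).det = A.det ^ 2 *
    (Matrix.of fun i j : Fin d ↦ (inner ℝ (S (EuclideanSpace.single i (1 : ℝ)))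
      (S (EuclideanSpace.single j (1 : ℝ))) : ℝ)).det := by
  let b := (EuclideanSpace.basisFun (Fin d) ℝ).toBasis
  set N := LinearMap.toMatrix b b (A : EuclideanSpace ℝ (Fin d) →ₗ[ℝ] _) with hN
  set G := (Matrix.of fun i j : Fin d ↦ (inner ℝ (S (EuclideanSpace.single i (1 : ℝ)))
      (S (EuclideanSpace.single j (1 : ℝ))) : ℝ)) with hG
  have hA : ∀ i, A (EuclideanSpace.single i (1 : ℝ)) =
      ∑ k, N k i • EuclideanSpace.single k (1 : ℝ) := by
    intro i
    have := b.sum_repr (A (EuclideanSpace.single i (1 : ℝ)))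
    rw [← this]
    refine Finset.sum_congr rfl fun k _ ↦ ?_
    simp [b, hN, LinearMap.toMatrix_apply]
  have hM : (Matrix.of fun i j : Fin d ↦ (inner ℝ (S (A (EuclideanSpace.single i (1 : ℝ))))
      (S (A (EuclideanSpace.single j (1 : ℝ)))) : ℝ)) = N.transpose * G * N := by
    ext i j
    simp only [Matrix.of_apply, hA, map_sum, map_smul, sum_inner, inner_sum, real_inner_smul_left,
      real_inner_smul_right, Matrix.mul_apply, Matrix.transpose_apply, hG, Finset.sum_mul]
    exact Finset.sum_congr rfl fun _ _ ↦ Finset.sum_congr rfl fun _ _ ↦ by ring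
  have hdet : N.det = A.det := LinearMap.det_toMatrix b _
  rw [hM, Matrix.det_mul, Matrix.det_mul, Matrix.det_transpose, hdet]
  ring

end GramDet

/-! ### Chart changes, coordinate components and the volume density -/

section Coordinates

variable {d : ℕ} {M : Type*} [TopologicalSpace M] [ChartedSpace (EuclideanSpace ℝ (Fin d)) M]
  [IsManifold (𝓡 d) ∞ M]

local notation "𝔼" => EuclideanSpace ℝ (Fin d)

local notation "φ" => extChartAt (𝓡 d) (M := M)

/-- The trivialization of the tangent bundle over the chart domain around `x`. -/
local notation "τ" => trivializationAt 𝔼 (fun p : M ↦ TangentSpace (𝓡 d) p)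

/-- Together with `mfderiv_extChartAt_eq`, this turns chart differentials into trivialization maps
of the tangent bundle, from which invertibility and smoothness in coordinates follow. -/
theorem mfderiv_extChartAt_symm_eq {x : M} {y : 𝔼} (hy : y ∈ (φ x).target) :
    mfderiv (𝓡 d) (𝓡 d) (φ x).symm y = (τ x).symmL ℝ ((φ x).symm y) := by
  have h := (φ x).map_target hy
  rw [extChartAt_source] at h
  rw [TangentBundle.symmL_trivializationAt h, (φ x).right_inv hy, ModelWithCorners.range_eq_univ,
    mfderivWithin_univ]

theorem mfderiv_extChartAt_eq {x p : M} (hp : p ∈ (φ x).source) :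
    mfderiv (𝓡 d) (𝓡 d) (φ x) p = (τ x).continuousLinearMapAt ℝ p := by
  rw [extChartAt_source] at hp
  rw [TangentBundle.continuousLinearMapAt_trivializationAt hp]

theorem mem_baseSet_of_mem_source {x p : M} (hp : p ∈ (φ x).source) : p ∈ (τ x).baseSet := by
  simpa using hp

theorem coordField_eq (V : (p : M) → TangentSpace (𝓡 d) p) {x : M} {y : 𝔼}
    (hy : y ∈ (φ x).target) :
    coordField V x y = (τ x ⟨(φ x).symm y, V ((φ x).symm y)⟩).2 := by
  have h := (φ x).map_target hy
  rw [coordField, mfderiv_extChartAt_eq h]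
  exact Trivialization.continuousLinearMapAt_apply_of_mem (R := ℝ) (τ x) (mem_baseSet_of_mem_source h) _

theorem contDiffOn_coordField {V : (p : M) → TangentSpace (𝓡 d) p} (hV : IsC1VectorField V)
    (x : M) : ContDiffOn ℝ 1 (coordField V x) (φ x).target := by
  have h1 : ContMDiffOn (𝓡 d) 𝓘(ℝ, 𝔼) 1 (fun p ↦ (τ x ⟨p, V p⟩).2) (τ x).baseSet :=
    ((τ x).contMDiffOn_section_baseSet_iff).1 hV.contMDiffOn
  have h2 : ContMDiffOn 𝓘(ℝ, 𝔼) (𝓡 d) 1 (φ x).symm (φ x).target := contMDiffOn_extChartAt_symm x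
  rw [← contMDiffOn_iff_contDiffOn]
  exact (h1.comp h2 fun y hy ↦ mem_baseSet_of_mem_source ((φ x).map_target hy)).congr
    fun y hy ↦ coordField_eq V hy

/-- The change of coordinates from the chart around `p` to the chart around `x`. -/
noncomputable def transitionMap (p x : M) : 𝔼 → 𝔼 := fun y ↦ φ x ((φ p).symm y)

theorem contDiffAt_transitionMap {p x : M} {y : 𝔼} (hy : y ∈ (φ p).target)
    (hx : (φ p).symm y ∈ (φ x).source) : ContDiffAt ℝ 2 (transitionMap p x) y := by
  rw [← contMDiffAt_iff_contDiffAt]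
  exact (contMDiffAt_extChartAt' (by simpa using hx)).comp y
    ((contMDiffOn_extChartAt_symm p).contMDiffAt ((isOpen_extChartAt_target p).mem_nhds hy))

theorem fderiv_transitionMap {p x : M} {y : 𝔼} (hy : y ∈ (φ p).target)
    (hx : (φ p).symm y ∈ (φ x).source) :
    fderiv ℝ (transitionMap p x) y =
      (τ x).continuousLinearMapAt ℝ ((φ p).symm y) ∘L (τ p).symmL ℝ ((φ p).symm y) := by
  rw [← mfderiv_extChartAt_symm_eq hy, ← mfderiv_extChartAt_eq hx, ← mfderiv_eq_fderiv]
  refine mfderiv_comp y (mdifferentiableAt_extChartAt (by simpa using hx)) ?_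
  exact (((contMDiffOn_extChartAt_symm p).contMDiffAt
    ((isOpen_extChartAt_target p).mem_nhds hy)) : ContMDiffAt _ _ 1 _ _).mdifferentiableAt one_ne_zero

theorem symmL_fderiv_transitionMap {p x : M} {y : 𝔼} (hy : y ∈ (φ p).target)
    (hx : (φ p).symm y ∈ (φ x).source) (u : 𝔼) :
    (τ x).symmL ℝ ((φ p).symm y) (fderiv ℝ (transitionMap p x) y u) =
      (τ p).symmL ℝ ((φ p).symm y) u := by
  rw [fderiv_transitionMap hy hx]
  exact (τ x).symmL_continuousLinearMapAt (mem_baseSet_of_mem_source hx) _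

theorem fderiv_transitionMap_coordField (V : (p : M) → TangentSpace (𝓡 d) p) {p x : M} {y : 𝔼}
    (hy : y ∈ (φ p).target) (hx : (φ p).symm y ∈ (φ x).source) :
    fderiv ℝ (transitionMap p x) y (coordField V p y) =
      coordField V x (transitionMap p x y) := by
  have h := (φ p).map_target hy
  have h' : coordField V x (transitionMap p x y) =
      (τ x ⟨(φ p).symm y, V ((φ p).symm y)⟩).2 := by
    rw [transitionMap, coordField_eq V ((φ x).map_source hx), (φ x).left_inv hx]
  rw [h', fderiv_transitionMap hy hx, coordField, mfderiv_extChartAt_eq h]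
  change (τ x).continuousLinearMapAt ℝ _ ((τ p).symmL ℝ _ ((τ p).continuousLinearMapAt ℝ _ _)) = _
  rw [(τ p).symmL_continuousLinearMapAt (mem_baseSet_of_mem_source h)]
  exact Trivialization.continuousLinearMapAt_apply_of_mem (R := ℝ) (τ x) (mem_baseSet_of_mem_source hx) _

theorem fderiv_transitionMap_comp_inverse {p x : M} {y : 𝔼} (hy : y ∈ (φ p).target)
    (hx : (φ p).symm y ∈ (φ x).source) :
    ∃ B : 𝔼 →L[ℝ] 𝔼, fderiv ℝ (transitionMap p x) y ∘L B = .id ℝ 𝔼 ∧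
      B ∘L fderiv ℝ (transitionMap p x) y = .id ℝ 𝔼 := by
  have h := mem_baseSet_of_mem_source ((φ p).map_target hy)
  have h' := mem_baseSet_of_mem_source hx
  refine ⟨(τ p).continuousLinearMapAt ℝ ((φ p).symm y) ∘L (τ x).symmL ℝ ((φ p).symm y), ?_, ?_⟩ <;>
  · rw [fderiv_transitionMap hy hx]
    ext1 u
    simp only [ContinuousLinearMap.comp_apply, ContinuousLinearMap.id_apply]
    rw [Trivialization.symmL_continuousLinearMapAt _ (by assumption),
      Trivialization.continuousLinearMapAt_symmL _ (by assumption)]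

variable [RiemannianBundle (fun x : M ↦ TangentSpace (𝓡 d) x)]

theorem gramMatrix_eq {x : M} {y : 𝔼} (hy : y ∈ (φ x).target) :
    gramMatrix x y = Matrix.of fun i j ↦
      (inner ℝ ((τ x).symmL ℝ ((φ x).symm y) (EuclideanSpace.single i (1 : ℝ)))
        ((τ x).symmL ℝ ((φ x).symm y) (EuclideanSpace.single j (1 : ℝ))) : ℝ) := by
  ext i j
  simp only [gramMatrix, coordVector, Matrix.of_apply]
  rw [mfderiv_extChartAt_symm_eq hy]
  rfl

/-- The coordinate vectors are linearly independent, so their Gram matrix is positive definite. -/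
theorem det_gramMatrix_pos {x : M} {y : 𝔼} (hy : y ∈ (φ x).target) :
    0 < (gramMatrix x y).det := by
  rw [gramMatrix_eq hy]
  have hinj : Function.Injective ((τ x).symmL ℝ ((φ x).symm y)) :=
    Function.LeftInverse.injective
      ((τ x).continuousLinearMapAt_symmL (mem_baseSet_of_mem_source ((φ x).map_target hy)))
  have hli : LinearIndependent ℝ fun i : Fin d ↦
      (τ x).symmL ℝ ((φ x).symm y) (EuclideanSpace.single i (1 : ℝ)) := by
    have := (EuclideanSpace.basisFun (Fin d) ℝ).toBasis.linearIndependent.map'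
      ((τ x).symmL ℝ ((φ x).symm y)).toLinearMap (LinearMap.ker_eq_bot.2 hinj)
    have h : (fun i : Fin d ↦ (τ x).symmL ℝ ((φ x).symm y) (EuclideanSpace.single i (1 : ℝ))) =
        ((τ x).symmL ℝ ((φ x).symm y)).toLinearMap ∘
          (EuclideanSpace.basisFun (Fin d) ℝ).toBasis := by
      ext1 i
      simp
      rfl
    rw [h]
    exact this
  exact (Matrix.posDef_gram_of_linearIndependent hli).det_pos

theorem volumeDensity_pos {x : M} {y : 𝔼} (hy : y ∈ (φ x).target) : 0 < volumeDensity x y :=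
  Real.sqrt_pos.2 (det_gramMatrix_pos hy)

/-- Square root of `det_gram_comp`. The absolute value remains because chart changes may reverse
orientation. -/
theorem volumeDensity_transitionMap {p x : M} {y : 𝔼} (hy : y ∈ (φ p).target)
    (hx : (φ p).symm y ∈ (φ x).source) :
    volumeDensity p y =
      |(fderiv ℝ (transitionMap p x) y).det| * volumeDensity x (transitionMap p x y) := by
  have h : (gramMatrix p y).det = (fderiv ℝ (transitionMap p x) y).det ^ 2 *
      (gramMatrix x (transitionMap p x y)).det := by
    have h' : transitionMap p x y ∈ (φ x).target := (φ x).map_source hx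
    have h'' : (φ x).symm (transitionMap p x y) = (φ p).symm y := (φ x).left_inv hx
    rw [gramMatrix_eq hy, gramMatrix_eq h', h'']
    simp only [← symmL_fderiv_transitionMap hy hx]
    exact det_gram_comp ((τ x).symmL ℝ ((φ p).symm y)).toLinearMap _
  rw [volumeDensity, h, Real.sqrt_mul (sq_nonneg _), Real.sqrt_sq_eq_abs, volumeDensity]

variable [IsContMDiffRiemannianBundle (𝓡 d) ∞ (EuclideanSpace ℝ (Fin d)) (fun x : M ↦ TangentSpace (𝓡 d) x)]

theorem contDiffOn_volumeDensity (x : M) : ContDiffOn ℝ 1 (volumeDensity x) (φ x).target := by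
  have : IsContMDiffRiemannianBundle (𝓡 d) 1 (EuclideanSpace ℝ (Fin d))
      (fun x : M ↦ TangentSpace (𝓡 d) x) := .of_le (n := ∞) (by norm_num)
  have hs : ∀ i, ContMDiffOn (𝓡 d) ((𝓡 d).prod 𝓘(ℝ, 𝔼)) 1
      (fun p ↦ (⟨p, (τ x).symmL ℝ p (EuclideanSpace.single i (1 : ℝ))⟩ :
        TotalSpace 𝔼 (fun p : M ↦ TangentSpace (𝓡 d) p))) (τ x).baseSet := by
    intro i
    rw [(τ x).contMDiffOn_section_baseSet_iff]
    refine (contMDiffOn_const (c := EuclideanSpace.single i (1 : ℝ))).congr fun p hp ↦ ?_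
    have := (τ x).continuousLinearMapAt_symmL (R := ℝ) hp (EuclideanSpace.single i (1 : ℝ))
    rwa [Trivialization.continuousLinearMapAt_apply,
      Trivialization.coe_linearMapAt_of_mem _ hp] at this
  have h2 : ContMDiffOn 𝓘(ℝ, 𝔼) (𝓡 d) 1 (φ x).symm (φ x).target := contMDiffOn_extChartAt_symm x
  have h3 : ∀ i j, ContDiffOn ℝ 1 (fun y ↦ gramMatrix x y i j) (φ x).target := by
    intro i j
    rw [← contMDiffOn_iff_contDiffOn]
    refine (((hs i).inner_bundle (hs j)).comp h2 fun y hy ↦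
      mem_baseSet_of_mem_source ((φ x).map_target hy)).congr fun y hy ↦ ?_
    rw [gramMatrix_eq hy, Matrix.of_apply]
    rfl
  have h4 : ContDiffOn ℝ 1 (fun y ↦ (gramMatrix x y).det) (φ x).target := by
    simp only [Matrix.det_apply']
    exact ContDiffOn.sum fun σ _ ↦ contDiffOn_const.mul (contDiffOn_prod fun i _ ↦ h3 _ _)
  -- The square root is smooth away from `0`, and the Gram determinant never vanishes on the chart.
  exact h4.sqrt fun y hy ↦ (det_gramMatrix_pos hy).ne'

end Coordinates

/-! ### Chart independence, continuity and the Leibniz rule for the divergence -/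

section Divergence

variable {d : ℕ} {M : Type*} [TopologicalSpace M] [ChartedSpace (EuclideanSpace ℝ (Fin d)) M]

local notation "𝔼" => EuclideanSpace ℝ (Fin d)

local notation "φ" => extChartAt (𝓡 d) (M := M)

theorem coordField_sub (V W : (p : M) → TangentSpace (𝓡 d) p) (x : M) (y : 𝔼) :
    coordField (fun p ↦ V p - W p) x y = coordField V x y - coordField W x y :=
  map_sub (mfderiv (𝓡 d) (𝓡 d) (φ x) ((φ x).symm y)) _ _

theorem coordField_smul (f : M → ℝ) (V : (p : M) → TangentSpace (𝓡 d) p) (x : M) (y : 𝔼) :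
    coordField (fun p ↦ f p • V p) x y = f ((φ x).symm y) • coordField V x y :=
  map_smul (mfderiv (𝓡 d) (𝓡 d) (φ x) ((φ x).symm y)) _ _

variable [IsManifold (𝓡 d) ∞ M]

theorem isC1VectorField_sub {V W : (p : M) → TangentSpace (𝓡 d) p} (hV : IsC1VectorField V)
    (hW : IsC1VectorField W) : IsC1VectorField (fun p ↦ V p - W p) :=
  ContMDiff.sub_section hV hW

theorem isC1VectorField_smul {f : M → ℝ} {V : (p : M) → TangentSpace (𝓡 d) p}
    (hf : ContMDiff (𝓡 d) 𝓘(ℝ, ℝ) 1 f) (hV : IsC1VectorField V) :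
    IsC1VectorField (fun p ↦ f p • V p) :=
  ContMDiff.smul_section hf hV

theorem fderiv_comp_symm_coordField {f : M → ℝ} (V : (p : M) → TangentSpace (𝓡 d) p) {x : M}
    {y : 𝔼} (hy : y ∈ (φ x).target)
    (hf : MDifferentiableAt (𝓡 d) 𝓘(ℝ, ℝ) f ((φ x).symm y)) :
    fderiv ℝ (fun z ↦ f ((φ x).symm z)) y (coordField V x y) =
      (mfderiv (𝓡 d) 𝓘(ℝ, ℝ) f ((φ x).symm y) (V ((φ x).symm y)) : ℝ) := by
  have h := (φ x).map_target hy
  have h1 : mfderiv 𝓘(ℝ, 𝔼) 𝓘(ℝ, ℝ) (fun z ↦ f ((φ x).symm z)) y =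
      mfderiv (𝓡 d) 𝓘(ℝ, ℝ) f ((φ x).symm y) ∘L mfderiv (𝓡 d) (𝓡 d) (φ x).symm y :=
    mfderiv_comp y hf ((((contMDiffOn_extChartAt_symm x).contMDiffAt
      ((isOpen_extChartAt_target x).mem_nhds hy)) :
        ContMDiffAt _ _ 1 _ _).mdifferentiableAt one_ne_zero)
  rw [← mfderiv_eq_fderiv, h1, mfderiv_extChartAt_symm_eq hy, coordField, mfderiv_extChartAt_eq h]
  exact congrArg (mfderiv (𝓡 d) 𝓘(ℝ, ℝ) f ((φ x).symm y))
    (Trivialization.symmL_continuousLinearMapAt _ (mem_baseSet_of_mem_source h) _)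

variable [RiemannianBundle (fun x : M ↦ TangentSpace (𝓡 d) x)]

/-- The vector density `√g V` in the chart around `x`. -/
noncomputable def weightedField (V : (p : M) → TangentSpace (𝓡 d) p) (x : M) (y : 𝔼) : 𝔼 :=
  volumeDensity x y • coordField V x y

theorem weightedField_transitionMap (V : (p : M) → TangentSpace (𝓡 d) p) {p x : M} {y : 𝔼}
    (hy : y ∈ (φ p).target) (hx : (φ p).symm y ∈ (φ x).source) :
    fderiv ℝ (transitionMap p x) y (weightedField V p y) =
      |(fderiv ℝ (transitionMap p x) y).det| • weightedField V x (transitionMap p x y) := by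
  rw [weightedField, weightedField, map_smul, fderiv_transitionMap_coordField V hy hx,
    volumeDensity_transitionMap hy hx, mul_smul]

variable [IsContMDiffRiemannianBundle (𝓡 d) ∞ (EuclideanSpace ℝ (Fin d))
  (fun x : M ↦ TangentSpace (𝓡 d) x)]

theorem contDiffOn_weightedField {V : (p : M) → TangentSpace (𝓡 d) p} (hV : IsC1VectorField V)
    (x : M) : ContDiffOn ℝ 1 (weightedField V x) (φ x).target :=
  (contDiffOn_volumeDensity x).smul (contDiffOn_coordField hV x)

theorem differentiableAt_weightedField {V : (p : M) → TangentSpace (𝓡 d) p}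
    (hV : IsC1VectorField V) {x : M} {y : 𝔼} (hy : y ∈ (φ x).target) :
    DifferentiableAt ℝ (weightedField V x) y :=
  ((contDiffOn_weightedField hV x).contDiffAt
    ((isOpen_extChartAt_target x).mem_nhds hy)).differentiableAt one_ne_zero

theorem riemannianDiv_eq {V : (p : M) → TangentSpace (𝓡 d) p} (hV : IsC1VectorField V) (x : M) :
    riemannianDiv V x =
      (volumeDensity x (φ x x))⁻¹ * euclideanDiv (weightedField V x) (φ x x) := by
  rw [← sum_fderiv_eq_euclideanDiv (differentiableAt_weightedField hV (mem_extChartAt_target x))]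
  rfl

/-- The Riemannian divergence can be computed in any chart. -/
theorem riemannianDiv_eq_of_mem_source {V : (p : M) → TangentSpace (𝓡 d) p}
    (hV : IsC1VectorField V) {x p : M} (hp : p ∈ (φ x).source) :
    riemannianDiv V p =
      (volumeDensity x (φ x p))⁻¹ * euclideanDiv (weightedField V x) (φ x p) := by
  set y := φ p p with hy_def
  have hy : y ∈ (φ p).target := mem_extChartAt_target p
  have hyp : (φ p).symm y = p := extChartAt_to_inv p
  have hx : (φ p).symm y ∈ (φ x).source := by rwa [hyp]
  have hT : transitionMap p x y = φ x p := by rw [transitionMap, hyp]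
  obtain ⟨B, hAB, hBA⟩ := fderiv_transitionMap_comp_inverse hy hx
  have hdet : (fderiv ℝ (transitionMap p x) y).det ≠ 0 := by
    have h1 : (fderiv ℝ (transitionMap p x) y).det * B.det = 1 := by
      have h2 := congrArg (fun F : 𝔼 →L[ℝ] 𝔼 ↦ LinearMap.det (F : 𝔼 →ₗ[ℝ] 𝔼)) hAB
      exact (LinearMap.det_comp _ _).symm.trans (h2.trans LinearMap.det_id)
    exact left_ne_zero_of_mul_eq_one h1
  have hcont : ContinuousAt (fun z ↦ (fderiv ℝ (transitionMap p x) z).det) y :=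
    ContinuousLinearMap.continuous_det.continuousAt.comp
      ((contDiffAt_transitionMap hy hx).continuousAt_fderiv (by norm_num))
  -- The Jacobian is continuous and nonzero at `y`, so its sign `c = ±1` is constant nearby. This
  -- replaces the absolute value by the factor `c · det` of the Piola identity.
  obtain ⟨c, hc⟩ : ∃ c : ℝ, ∀ᶠ z in nhds y, |(fderiv ℝ (transitionMap p x) z).det| =
      c * (fderiv ℝ (transitionMap p x) z).det := by
    rcases hdet.lt_or_gt with h | h
    · exact ⟨-1, (hcont.eventually_lt continuousAt_const h).mono fun z hz ↦ by
        rw [abs_of_neg hz, neg_one_mul]⟩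
    · exact ⟨1, (continuousAt_const.eventually_lt hcont h).mono fun z hz ↦ by
        rw [abs_of_pos hz, one_mul]⟩
  have hnear : ∀ᶠ z in nhds y, z ∈ (φ p).target ∧ (φ p).symm z ∈ (φ x).source :=
    Filter.Eventually.and ((isOpen_extChartAt_target p).mem_nhds hy)
      ((continuousAt_extChartAt_symm'' hy).preimage_mem_nhds
        ((isOpen_extChartAt_source x).mem_nhds hx))
  have key := euclideanDiv_piola (c := c) (contDiffAt_transitionMap hy hx) hAB hBA
    (differentiableAt_weightedField hV hy)
    (differentiableAt_weightedField hV (x := x) ((φ x).map_source hx)) (by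
      filter_upwards [hc, hnear] with z hz hz'
      rw [weightedField_transitionMap V hz'.1 hz'.2, hz])
  rw [riemannianDiv_eq hV, ← hy_def, key, volumeDensity_transitionMap hy hx, ← hc.self_of_nhds, hT,
    mul_inv, mul_mul_mul_comm, inv_mul_cancel₀ (abs_ne_zero.2 hdet), one_mul]

/-- Near `x` the divergence can be computed in the single chart around `x`, where the formula has
continuous ingredients. -/
theorem continuous_riemannianDiv {V : (p : M) → TangentSpace (𝓡 d) p} (hV : IsC1VectorField V) :
    Continuous (riemannianDiv V) := by
  refine continuous_iff_continuousAt.2 fun x ↦ ?_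
  have htr : Continuous fun F : 𝔼 →L[ℝ] 𝔼 ↦ LinearMap.trace ℝ 𝔼 (F : 𝔼 →ₗ[ℝ] 𝔼) :=
    (LinearMap.trace ℝ 𝔼 ∘ₗ ContinuousLinearMap.coeLM ℝ :
      (𝔼 →L[ℝ] 𝔼) →ₗ[ℝ] ℝ).continuous_of_finiteDimensional
  have hx := mem_extChartAt_target (I := 𝓡 d) x
  have hnhds := (isOpen_extChartAt_target (I := 𝓡 d) x).mem_nhds hx
  have h1 : ContinuousAt (fun y ↦ (volumeDensity x y)⁻¹ * euclideanDiv (weightedField V x) y)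
      (φ x x) :=
    (((contDiffOn_volumeDensity x).contDiffAt hnhds).continuousAt.inv₀
      (volumeDensity_pos hx).ne').mul (htr.continuousAt.comp
        (((contDiffOn_weightedField hV x).contDiffAt hnhds).continuousAt_fderiv one_ne_zero))
  refine (h1.comp (continuousAt_extChartAt (I := 𝓡 d) x)).congr ?_
  filter_upwards [(isOpen_extChartAt_source (I := 𝓡 d) x).mem_nhds (mem_extChartAt_source x)]
    with p hp
  exact (riemannianDiv_eq_of_mem_source hV hp).symm

theorem riemannianDiv_sub {V W : (p : M) → TangentSpace (𝓡 d) p} (hV : IsC1VectorField V)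
    (hW : IsC1VectorField W) (x : M) :
    riemannianDiv (fun p ↦ V p - W p) x = riemannianDiv V x - riemannianDiv W x := by
  have hx := mem_extChartAt_target (I := 𝓡 d) x
  have h : weightedField (fun p ↦ V p - W p) x = weightedField V x - weightedField W x := by
    funext y
    simp only [weightedField, coordField_sub, smul_sub, Pi.sub_apply]
  rw [riemannianDiv_eq (isC1VectorField_sub hV hW), riemannianDiv_eq hV, riemannianDiv_eq hW,
    ← mul_sub, h, euclideanDiv, fderiv_sub (differentiableAt_weightedField hV hx)
      (differentiableAt_weightedField hW hx)]
  exact congrArg _ (map_sub (LinearMap.trace ℝ 𝔼) _ _)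

/-- The Leibniz rule `div(f V) = f div V + df(V)`. -/
theorem riemannianDiv_smul {f : M → ℝ} {V : (p : M) → TangentSpace (𝓡 d) p}
    (hf : ContMDiff (𝓡 d) 𝓘(ℝ, ℝ) 1 f) (hV : IsC1VectorField V) (x : M) :
    riemannianDiv (fun p ↦ f p • V p) x - f x * riemannianDiv V x =
      (mfderiv (𝓡 d) 𝓘(ℝ, ℝ) f x (V x) : ℝ) := by
  have hx := mem_extChartAt_target (I := 𝓡 d) x
  set y := φ x x with hy
  have hyx : (φ x).symm y = x := extChartAt_to_inv x
  have h : weightedField (fun p ↦ f p • V p) x =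
      fun y ↦ f ((φ x).symm y) • weightedField V x y := by
    funext y
    simp only [weightedField, coordField_smul]
    rw [smul_comm]
  have hg : DifferentiableAt ℝ (fun z ↦ f ((φ x).symm z)) y := by
    have : ContMDiffAt 𝓘(ℝ, 𝔼) 𝓘(ℝ, ℝ) 1 (fun z ↦ f ((φ x).symm z)) y :=
      hf.contMDiffAt.comp y ((contMDiffOn_extChartAt_symm x).contMDiffAt
        ((isOpen_extChartAt_target x).mem_nhds hx))
    exact this.contDiffAt.differentiableAt one_ne_zero
  have hd : fderiv ℝ (fun z ↦ f ((φ x).symm z)) y (coordField V x y) =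
      (mfderiv (𝓡 d) 𝓘(ℝ, ℝ) f x (V x) : ℝ) := by
    rw [fderiv_comp_symm_coordField V hx (hf.mdifferentiableAt one_ne_zero)]
    exact congrArg (fun q ↦ (mfderiv (𝓡 d) 𝓘(ℝ, ℝ) f q (V q) : ℝ)) hyx
  have htr : euclideanDiv (fun y ↦ f ((φ x).symm y) • weightedField V x y) y =
      f x * euclideanDiv (weightedField V x) y +
        fderiv ℝ (fun z ↦ f ((φ x).symm z)) y (weightedField V x y) := by
    rw [euclideanDiv, fderiv_fun_smul hg (differentiableAt_weightedField hV hx), hyx]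
    refine (map_add (LinearMap.trace ℝ 𝔼) _ _).trans ?_
    congr 1
    · exact map_smul (LinearMap.trace ℝ 𝔼) _ _
    · exact LinearMap.trace_smulRight _ _
  rw [riemannianDiv_eq (isC1VectorField_smul hf hV), riemannianDiv_eq hV, ← hy, h, htr, ← hd,
    weightedField, map_smul, smul_eq_mul]
  have := (volumeDensity_pos hx).ne'
  field_simp
  ring

/-- If `div V = 0 = div(f V)`, then `df(V) = 0`. -/
theorem mfderiv_eq_zero_of_riemannianDiv_eq_zero {f : M → ℝ} {V : (p : M) → TangentSpace (𝓡 d) p}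
    (hf : ContMDiff (𝓡 d) 𝓘(ℝ, ℝ) 1 f) (hV : IsC1VectorField V) {x : M}
    (h0 : riemannianDiv V x = 0) (h : riemannianDiv (fun p ↦ f p • V p) x = 0) :
    (mfderiv (𝓡 d) 𝓘(ℝ, ℝ) f x (V x) : ℝ) = 0 := by
  have e : riemannianDiv (fun p ↦ f p • V p) x - f x * riemannianDiv V x = 0 := by
    rw [h0, h, mul_zero, sub_zero]
  exact (riemannianDiv_smul hf hV x).symm.trans e

end Divergence

/-! ### Positivity of the Riemannian volume on open sets -/

section Volume

variable {d : ℕ} {M : Type*} [TopologicalSpace M] [ChartedSpace (EuclideanSpace ℝ (Fin d)) M]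
  [IsManifold (𝓡 d) ∞ M] [RiemannianBundle (fun x : M ↦ TangentSpace (𝓡 d) x)]
  [IsContMDiffRiemannianBundle (𝓡 d) ∞ (EuclideanSpace ℝ (Fin d))
    (fun x : M ↦ TangentSpace (𝓡 d) x)]
  [MeasurableSpace M] [BorelSpace M]

variable (d M) in
-- The volume dominates that of a chart around any point of the open set. There it has a strictly
-- positive density against Lebesgue measure on a nonempty open set.
theorem isOpenPosMeasure_riemannianVolume :
    Measure.IsOpenPosMeasure (riemannianVolume d M) := by
  refine ⟨fun U hU ⟨p, hp⟩ h0 ↦ ?_⟩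
  have hle : chartVolume (d := d) p ≤ riemannianVolume d M := le_iSup (chartVolume (d := d)) p
  have h1 : chartVolume (d := d) p U = 0 := le_antisymm ((hle U).trans h0.le) zero_le
  have hopen := isOpen_extChartAt_target (I := 𝓡 d) p
  have hm : AEMeasurable (fun y ↦ ENNReal.ofReal (volumeDensity p y))
      (volume.restrict (extChartAt (𝓡 d) p).target) :=
    ((contDiffOn_volumeDensity p).continuousOn.aemeasurable hopen.measurableSet).ennreal_ofReal
  have hs : AEMeasurable (extChartAt (𝓡 d) p).symm
      (volume.restrict (extChartAt (𝓡 d) p).target) :=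
    (continuousOn_extChartAt_symm p).aemeasurable hopen.measurableSet
  rw [chartVolume, Measure.map_apply_of_aemeasurable
    (hs.mono_ac (withDensity_absolutelyContinuous _ _)) hU.measurableSet,
    withDensity_apply_eq_zero' hm, Measure.restrict_apply' hopen.measurableSet] at h1
  set O := (extChartAt (𝓡 d) p).target ∩ (extChartAt (𝓡 d) p).symm ⁻¹' U
  have hO : IsOpen O := (continuousOn_extChartAt_symm p).isOpen_inter_preimage hopen hU
  have hne : O.Nonempty := ⟨extChartAt (𝓡 d) p p, mem_extChartAt_target p, by
    rwa [Set.mem_preimage, extChartAt_to_inv]⟩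
  refine (hO.measure_pos volume hne).ne' (measure_mono_null (fun y hy ↦ ?_) h1)
  refine ⟨⟨?_, hy.2⟩, hy.1⟩
  exact (ENNReal.ofReal_pos.2 (volumeDensity_pos hy.1)).ne'

end Volume

/-! ### From the weak equation to the vector field -/

section Reconstruction

variable {d : ℕ} {M : Type*} [TopologicalSpace M] [CompactSpace M]
  [ChartedSpace (EuclideanSpace ℝ (Fin d)) M]
  [RiemannianBundle (fun x : M ↦ TangentSpace (𝓡 d) x)]
  [MeasurableSpace M]

/-- By compactness an integrable `ρ j` is bounded below by its positive minimum, so the total mass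
is finite. -/
theorem isFiniteMeasure_riemannianVolume {m : ℕ} {ρ : Fin m → M → ℝ} {j : Fin m}
    (hρ : ρ ∈ positiveDensities d M m) : IsFiniteMeasure (riemannianVolume d M) := by
  obtain ⟨hc, hpos, hint⟩ := hρ j
  have hi : Integrable (ρ j) (riemannianVolume d M) := by
    -- A non-integrable function has Bochner integral `0`, whereas this integral is `1`.
    by_contra h
    rw [integral_undef h] at hint
    exact zero_ne_one hint
  rcases isEmpty_or_nonempty M with hM | hM
  · infer_instance
  obtain ⟨x₀, -, hx₀⟩ := isCompact_univ.exists_isMinOn Set.univ_nonempty hc.continuous.continuousOn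
  refine ⟨(measure_mono fun x _ ↦ ?_).trans_lt (hi.measure_ge_lt_top (hpos x₀))⟩
  exact hx₀ (Set.mem_univ x)

variable [T2Space M] [IsManifold (𝓡 d) ∞ M]
  [IsContMDiffRiemannianBundle (𝓡 d) ∞ (EuclideanSpace ℝ (Fin d))
    (fun x : M ↦ TangentSpace (𝓡 d) x)] [BorelSpace M]

/-- The operator with density `ρ` determines the divergence of `ρ v`. -/
theorem ADRWeakEq.riemannianDiv_eq [IsFiniteMeasure (riemannianVolume d M)]
    {A : (x : M) → TangentSpace (𝓡 d) x →L[ℝ] TangentSpace (𝓡 d) x}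
    {R : Lp ℝ 1 (riemannianVolume d M) → Lp ℝ 1 (riemannianVolume d M)}
    {v w : (x : M) → TangentSpace (𝓡 d) x} (hv : IsC1VectorField v) (hw : IsC1VectorField w)
    {ρ : M → ℝ} (hρ : ContMDiff (𝓡 d) 𝓘(ℝ, ℝ) 1 ρ)
    {hρi : Integrable ρ (riemannianVolume d M)} (h : ADRWeakEq A R v w ρ hρi) (x : M) :
    riemannianDiv (fun p ↦ ρ p • v p) x = riemannianDiv (fun p ↦ ρ p • w p) x := by
  have hcv := continuous_riemannianDiv (isC1VectorField_smul hρ hv)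
  have hcw := continuous_riemannianDiv (isC1VectorField_smul hρ hw)
  have hint : ∀ {f : M → ℝ}, Continuous f → Integrable f (riemannianVolume d M) := fun hf ↦
    integrableOn_univ.1 (hf.continuousOn.integrableOn_compact isCompact_univ)
  have hae : ∀ᵐ x ∂(riemannianVolume d M),
      riemannianDiv (fun p ↦ ρ p • v p) x = riemannianDiv (fun p ↦ ρ p • w p) x := by
    refine ae_eq_of_integral_contMDiff_smul_eq (𝓡 d) (hint hcv).locallyIntegrable
      (hint hcw).locallyIntegrable fun φ hφ hφc ↦ ?_
    have := h φ hφ hφc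
    -- The reaction and diffusion integrals are identical on both sides and drop out.
    rw [adrPairing, adrPairing, add_left_inj, add_left_inj] at this
    simpa only [smul_eq_mul, mul_comm] using this
  have := isOpenPosMeasure_riemannianVolume d M
  exact congrFun (Measure.eq_of_ae_eq hae hcv hcw) x

end Reconstruction

theorem mainTheorem7 {d : ℕ} {M : Type*} [TopologicalSpace M] [T2Space M] [CompactSpace M]
    [ChartedSpace (EuclideanSpace ℝ (Fin d)) M] [IsManifold (𝓡 d) ∞ M]
    [RiemannianBundle (fun x : M ↦ TangentSpace (𝓡 d) x)]
    [IsContMDiffRiemannianBundle (𝓡 d) ∞ (EuclideanSpace ℝ (Fin d))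
      (fun x : M ↦ TangentSpace (𝓡 d) x)]
    [MeasurableSpace M] [BorelSpace M]
    (m : ℕ) (hm : 2 * d + 1 < m)
    (ρ : Fin m → M → ℝ) (hρ : ρ ∈ densitySet d M (Nat.zero_lt_of_lt hm))
    (v w : (x : M) → TangentSpace (𝓡 d) x)
    (hv : IsC1VectorField v) (hw : IsC1VectorField w)
    (A : (x : M) → TangentSpace (𝓡 d) x →L[ℝ] TangentSpace (𝓡 d) x)
    (hA : IsMeasurableTensor A) (hA' : IsBoundedTensor A)
    (R : Lp ℝ 1 (riemannianVolume d M) → Lp ℝ 1 (riemannianVolume d M))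
    (h : ∀ j : Fin m, ADRWeakEq A R v w (ρ j) (integrable_of_mem_densitySet hρ j)) :
    ∀ x : M, v x = w x := by
  intro x
  -- The zero-based index of the common denominator `ρₘ`.
  let l : Fin m := ⟨m - 1, by omega⟩
  have hfin := isFiniteMeasure_riemannianVolume (j := l) hρ.1
  have hu : IsC1VectorField (fun p ↦ v p - w p) := isC1VectorField_sub hv hw
  have hC : ∀ j, ContMDiff (𝓡 d) 𝓘(ℝ, ℝ) 1 (ρ j) := fun j ↦ (hρ.1 j).1
  have hpos : ∀ j p, 0 < ρ j p := fun j ↦ (hρ.1 j).2.1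
  have hdiv : ∀ j, riemannianDiv (fun p ↦ ρ j p • (v p - w p)) x = 0 := by
    intro j
    simp only [smul_sub]
    rw [riemannianDiv_sub (isC1VectorField_smul (hC j) hv) (isC1VectorField_smul (hC j) hw),
      (h j).riemannianDiv_eq hv hw (hC j), sub_self]
  have hY := hρ.2
  have hYd : HasMFDerivAt (𝓡 d) (𝓡 (m - 1)) (ratioMap (Nat.zero_lt_of_lt hm) ρ) x _ :=
    (hY.contMDiff.mdifferentiableAt one_ne_zero (x := x)).hasMFDerivAt
  have hzero : mfderiv (𝓡 d) (𝓡 (m - 1)) (ratioMap (Nat.zero_lt_of_lt hm) ρ) x (v x - w x) =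
      (0 : EuclideanSpace ℝ (Fin (m - 1))) := by
    refine PiLp.ext fun j ↦ ?_
    let pr : EuclideanSpace ℝ (Fin (m - 1)) →L[ℝ] ℝ := EuclideanSpace.proj j
    let f : M → ℝ := fun p ↦ ρ ⟨j, by omega⟩ p / ρ l p
    have hf : ContMDiff (𝓡 d) 𝓘(ℝ, ℝ) 1 f := (pr.contDiff.contMDiff).comp hY.contMDiff
    have h1 : HasMFDerivAt (𝓡 d) 𝓘(ℝ, ℝ) f x
        (pr ∘L mfderiv (𝓡 d) (𝓡 (m - 1)) (ratioMap (Nat.zero_lt_of_lt hm) ρ) x) :=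
      HasMFDerivAt.comp x pr.hasMFDerivAt hYd
    have h2 : (mfderiv (𝓡 d) 𝓘(ℝ, ℝ) f x (ρ l x • (v x - w x)) : ℝ) = 0 := by
      -- With `V = ρₘ u` and `f = ρⱼ/ρₘ`, the product `f V` is `ρⱼ u`, so both divergences vanish by
      -- `hdiv`.
      refine mfderiv_eq_zero_of_riemannianDiv_eq_zero (V := fun p ↦ ρ l p • (v p - w p)) hf
        (isC1VectorField_smul (hC l) hu) (hdiv l) ?_
      rw [← hdiv ⟨j, by omega⟩]
      congr 1
      funext p
      rw [smul_smul, div_mul_cancel₀ _ (hpos l p).ne']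
    rw [map_smul] at h2
    have h3 := (smul_eq_zero.1 h2).resolve_left (hpos l x).ne'
    rw [h1.mfderiv] at h3
    exact h3
  exact sub_eq_zero.1 (hY.injective_mfderiv x (hzero.trans (map_zero _).symm))
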